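/- Let $n\ge 3$ be odd, let $\mathcal V=\{1,\dots,n\}$ with indices read modulo $n$, and let $\mathcal S^2\subset\mathbb R^3$ be the unit sphere with geodesic distance $d_{\mathcal S^2}(x,y)=\arccos(x^Ty)$. Let the graph on $\mathcal V$ be an undirected ring, i.e. $\mathcal N_i=\{i-1,i+1\}$ for all $i$, or a directed ring, i.e. $\mathcal N_i=\{i+1\}$ for all $i$. On $(\mathcal S^2)^n$ consider the closed-loop system $$\dot\Gamma_i=\omega_i\times\Gamma_i,\qquad \omega_i=-\sum_{j\in\mathcal N_i}\Gamma_i\times\Gamma_j,\qquad\text{i.e.}\qquad \dot\Gamma_i=\Gamma_i\times\sum_{j\in\mathcal N_i}(\Gamma_i\times\Gamma_j),\qquad i\in\mathcal V.$$ For $u\in\mathbb R^3$ let $\widehat u$ be the matrix with $\widehat u\,y=u\times y$, and let $$\mathcal M_o=\{\mathbf\Gamma\in(\mathcal S^2)^n:\ \exists\,u,v\in\mathcal S^2,\ u^Tv=0,\ \Gamma_i=\exp\big((i-1)(\pi-\pi/n)\widehat u\big)v\ \ \forall i\in\mathcal V\}$$ be the set of cyclic formations. Put $d_{\mathcal M_o}(\mathbf\Gamma)=\inf_{\bar{\mathbf\Gamma}\in\mathcal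 M_o}\max_{i\in\mathcal V}d_{\mathcal S^2}(\Gamma_i,\bar\Gamma_i)$ and $W(\mathbf\Gamma)=\min_{i\in\mathcal V}d_{\mathcal S^2}(\Gamma_i,\Gamma_{i+1})$. Then $\mathcal M_o$ is positively invariant and asymptotically stable, that is: (i) (stability) for every $\varepsilon>0$ there is $\delta>0$ such that every trajectory with $d_{\mathcal M_o}(\mathbf\Gamma(0))<\delta$ satisfies $d_{\mathcal M_o}(\mathbf\Gamma(t))<\varepsilon$ for all $t\ge 0$; (ii) (attractivity) there is $\delta>0$ such that every state $\bar{\mathbf\Gamma}$ with $d_{\mathcal M_o}(\bar{\mathbf\Gamma})<\delta$ belongs to the region of attraction of $\mathcal M_o$, i.e. the trajectory starting at $\bar{\mathbf\Gamma}$ exists for all $t\ge0$ and $d_{\mathcal M_o}(\mathbf\Gamma(t))\to 0$ as $t\to\infty$. Moreover, the region of attraction of $\mathcal M_o$ contains $$\Omega_o=\{\mathbf\Gamma\in(\mathcal S^2)^n:\ W(\mathbf\Gamma)>\max\{\pi-3\pi/n,\ \pi/2\}\}.$$ -/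

import Mathlib

open Filter Topology

/-- Euclidean three-space. -/
abbrev E3 : Type := EuclideanSpace ℝ (Fin 3)

/-- The unit 2-sphere in `ℝ³`. -/
abbrev S2 : Type := Metric.sphere (0 : E3) 1

/-- The matrix `x^` of the map `y ↦ x × y`. -/
def hat (x : E3) : Matrix (Fin 3) (Fin 3) ℝ :=
  !![0, -x 2, x 1; x 2, 0, -x 0; -x 1, x 0, 0]

theorem hat_mulVec (x y : E3) :
    Matrix.mulVec (hat x) (WithLp.ofLp y) = crossProduct (WithLp.ofLp x) (WithLp.ofLp y) := by
  ext i
  fin_cases i <;> simp [hat, Matrix.mulVec, dotProduct, Fin.sum_univ_three, cross_apply] <;> ring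

/-- A `3 × 3` matrix applied to a vector of `ℝ³`. -/
def matVec (A : Matrix (Fin 3) (Fin 3) ℝ) (x : E3) : E3 :=
  WithLp.toLp 2 (Matrix.mulVec A (WithLp.ofLp x))

/-- The state space `(S²)ⁿ`; the agents `1, …, n` are indexed by `0, …, n - 1`,
and addition on `Fin n` is modulo `n`. -/
abbrev State (n : ℕ) : Type := Fin n → S2

/-- Geodesic distance on the 2-sphere. -/
noncomputable def geoDist (x y : S2) : ℝ :=
  Real.arccos (inner ℝ (x : E3) (y : E3))

/-- The metric on `(S²)ⁿ`: the maximum of the geodesic distances of the components. -/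
noncomputable def stateDist {n : ℕ} (Γ Δ : State n) : ℝ :=
  ⨆ i, geoDist (Γ i) (Δ i)

/-- The distance from a state to a set of states. -/
noncomputable def distTo {n : ℕ} (M : Set (State n)) (Γ : State n) : ℝ :=
  ⨅ Δ : M, stateDist Γ (Δ : State n)

/-- The set of neighbours of the agent `i`, i.e. of all `j` with an edge `(j, i)`. -/
noncomputable def neighbors {n : ℕ} (G : Digraph (Fin n)) (i : Fin n) : Finset (Fin n) := by
  classical exact Finset.univ.filter (fun j => G.Adj j i)

/-- Undirected ring: the neighbours of `i` are `i - 1` and `i + 1`. -/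
def IsUndirectedRing {n : ℕ} [NeZero n] (G : Digraph (Fin n)) : Prop :=
  ∀ i, neighbors G i = {i - 1, i + 1}

/-- Directed ring: the only neighbour of `i` is `i + 1`. -/
def IsDirectedRing {n : ℕ} [NeZero n] (G : Digraph (Fin n)) : Prop :=
  ∀ i, neighbors G i = {i + 1}

/-- The angular velocity `ω_i = - ∑_{j ∈ N_i} Γ_i × Γ_j` applied by the agent `i`. -/
noncomputable def angularVelocity {n : ℕ} (G : Digraph (Fin n)) (Γ : State n) (i : Fin n) : E3 :=
  - ∑ j ∈ neighbors G i, matVec (hat (Γ i)) (Γ j)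

/-- Forward trajectories (defined for all times `t ≥ 0`) of the closed-loop system
`dΓ_i/dt = ω_i × Γ_i`; the values of `γ` at negative times play no role. -/
def IsTrajectory {n : ℕ} (G : Digraph (Fin n)) (γ : ℝ → State n) : Prop :=
  ∀ t : ℝ, 0 ≤ t → ∀ i : Fin n,
    HasDerivWithinAt (fun s => ((γ s i : S2) : E3))
      (matVec (hat (angularVelocity G (γ t) i)) (γ t i)) (Set.Ici 0) t

/-- Positive invariance of a set of states. -/
def IsPosInvariant {n : ℕ} (G : Digraph (Fin n)) (M : Set (State n)) : Prop :=
  ∀ γ, IsTrajectory G γ → γ 0 ∈ M → ∀ t, 0 ≤ t → γ t ∈ M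

/-- Lyapunov stability of a set of states. -/
def IsStable {n : ℕ} (G : Digraph (Fin n)) (M : Set (State n)) : Prop :=
  ∀ ε > 0, ∃ δ > 0, ∀ γ, IsTrajectory G γ → distTo M (γ 0) < δ →
    ∀ t, 0 ≤ t → distTo M (γ t) < ε

/-- The region of attraction of `M`: the initial states whose trajectory exists for all
times `t ≥ 0` and approaches `M`. -/
def regionOfAttraction {n : ℕ} (G : Digraph (Fin n)) (M : Set (State n)) : Set (State n) :=
  {Γ₀ | (∃ γ, IsTrajectory G γ ∧ γ 0 = Γ₀) ∧
    ∀ γ, IsTrajectory G γ → γ 0 = Γ₀ → Tendsto (fun t => distTo M (γ t)) atTop (𝓝 0)}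

/-- Asymptotic stability: stability together with attraction of all states near `M`. -/
def IsAsymptoticallyStable {n : ℕ} (G : Digraph (Fin n)) (M : Set (State n)) : Prop :=
  IsStable G M ∧ ∃ δ > 0, ∀ Γ₀, distTo M Γ₀ < δ → Γ₀ ∈ regionOfAttraction G M

/-- The smallest geodesic distance between cyclically consecutive agents. -/
noncomputable def minNeighborDist {n : ℕ} [NeZero n] (Γ : State n) : ℝ :=
  ⨅ i, geoDist (Γ i) (Γ (i + 1))

/-- The cyclic formations: the agent with index `i` (counted from `0`) sits at
`exp (i (π - π / n) u^) v` for orthogonal unit vectors `u` and `v`. -/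
def cyclicFormation (n : ℕ) : Set (State n) :=
  {Γ | ∃ u v : S2, inner ℝ (u : E3) (v : E3) = 0 ∧
    ∀ i : Fin n, ((Γ i : S2) : E3) =
      matVec (NormedSpace.exp (((i : ℕ) * (Real.pi - Real.pi / n) : ℝ) • hat u)) v}

/-- The set `Ω_o` of states with smallest neighbour distance above
`max (π - 3π / n) (π / 2)`. -/
def cyclicBasin (n : ℕ) [NeZero n] : Set (State n) :=
  {Γ | minNeighborDist Γ > max (Real.pi - 3 * Real.pi / n) (Real.pi / 2)}

/-! Write `c_i = -⟪Γ_i, Γ_{i+1}⟫` and let `s_i` be the sine of the angle between `Γ_i` and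
`Γ_{i+1}`. Attention to the successor contributes `s_i (s_i - s_{i+1}) + D_i` to the derivative of
`c_i`, where `D_i ≥ 0` is the defect in the spherical triangle inequality (`succRate_eq`); attention
to the predecessor contributes the mirror image (`predRate_succ`).

Two facts follow. If `c_i ≥ 0` is the smallest, then `s_i` is the largest, so `c_i` does not
decrease: positive lower bounds on all `c_i` persist (`IsTrajectory.le_neg_nbrInner`). Summed around
the ring, the rates give `∑ ((s_i - s_{i+1})² / 2 + D_i) ≥ 0`, once or twice (`dissipation_eq`), so
the potential `∑ c_i` is nondecreasing and bounded, and Barbalat's lemma sends the dissipation to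
zero.

Where the dissipation vanishes and all `c_i > 0`, the points are equally spaced on a great circle
with step `π - θ`. Closing up after an odd number `n` of steps makes `n θ` an odd multiple of `π`,
and `c_i > cos (3π/n)` leaves only `θ = π/n` (`mem_cyclicFormation_of_dissipation_eq_zero`).
Compactness turns vanishing dissipation into convergence. Following the flow then shows that cyclic
formations are exactly the maximizers of the potential in this region, which gives invariance and
stability. -/

/-! ### Global existence of trajectories. -/

/-- A bounded `C¹` vector field on a finite-dimensional space has solutions for all times `t ≥ 0`. -/
theorem exists_forward_solution_of_contDiff_of_bounded {E : Type*} [NormedAddCommGroup E]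
    [NormedSpace ℝ E] [FiniteDimensional ℝ E] {f : E → E} (hf : ContDiff ℝ 1 f) {C : NNReal}
    (hC : ∀ x, ‖f x‖ ≤ C) (x₀ : E) :
    ∃ α : ℝ → E, α 0 = x₀ ∧
      ∀ t, 0 ≤ t → HasDerivWithinAt α (f (α t)) (Set.Ici 0) t := by
  have : CompleteSpace E := FiniteDimensional.complete ℝ E
  have : ProperSpace E := FiniteDimensional.proper ℝ E
  have lip : ∀ r : ℝ, ∃ K, LipschitzOnWith K f (Metric.closedBall x₀ r) := fun r =>
    hf.contDiffOn.exists_lipschitzOnWith one_ne_zero (convex_closedBall x₀ r)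
      (isCompact_closedBall x₀ r)
  have local_sol : ∀ N : ℕ, ∃ α : ℝ → E, α 0 = x₀ ∧ ∀ t ∈ Set.Icc (0 : ℝ) (N + 1),
      HasDerivWithinAt α (f (α t)) (Set.Icc (0 : ℝ) (N + 1)) t := by
    intro N
    obtain ⟨K, hK⟩ := lip (C * (N + 1) : NNReal)
    have h0 : (0 : ℝ) ∈ Set.Icc (0 : ℝ) (N + 1) := ⟨le_rfl, by positivity⟩
    -- At speed at most `C` a solution stays within `C (N + 1)` of `x₀` up to time `N + 1`, so this
    -- ball serves for Picard–Lindelöf on the whole interval.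
    have hP : IsPicardLindelof (fun _ : ℝ => f) (⟨0, h0⟩ : Set.Icc (0 : ℝ) (N + 1)) x₀
        (C * (N + 1)) 0 C K := by
      refine IsPicardLindelof.of_time_independent (fun x _ => hC x) hK ?_
      have : (0 : ℝ) ≤ N + 1 := by positivity
      simp [this]
    exact hP.exists_eq_forall_mem_Icc_hasDerivWithinAt₀
  choose α hα0 hα using local_sol
  have hcont : ∀ N, ContinuousOn (α N) (Set.Icc (0 : ℝ) (N + 1)) := fun N t ht =>
    (hα N t ht).continuousWithinAt
  have agree : ∀ N M : ℕ, N ≤ M → Set.EqOn (α N) (α M) (Set.Icc (0 : ℝ) (N + 1)) := by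
    intro N M hNM
    have hsub : Set.Icc (0 : ℝ) (N + 1) ⊆ Set.Icc (0 : ℝ) (M + 1) :=
      Set.Icc_subset_Icc_right (by exact_mod_cast Nat.succ_le_succ hNM)
    have hcM := (hcont M).mono hsub
    obtain ⟨r, hr⟩ := ((isCompact_Icc.image_of_continuousOn (hcont N)).isBounded.union
      (isCompact_Icc.image_of_continuousOn hcM).isBounded).subset_closedBall x₀
    obtain ⟨K, hK⟩ := lip r
    have right : ∀ P : ℕ, N ≤ P → ∀ t ∈ Set.Ico (0 : ℝ) (N + 1),
        HasDerivWithinAt (α P) (f (α P t)) (Set.Ici t) t := by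
      intro P hP t ht
      have hle : (N : ℝ) + 1 ≤ P + 1 := by exact_mod_cast Nat.succ_le_succ hP
      refine (hα P t ⟨ht.1, ht.2.le.trans hle⟩).mono_of_mem_nhdsWithin ?_
      exact mem_of_superset (Icc_mem_nhdsGE (ht.2.trans_le hle))
        (Set.Icc_subset_Icc_left ht.1)
    refine ODE_solution_unique_of_mem_Icc_right (v := fun _ => f)
      (s := fun _ => Metric.closedBall x₀ r) (fun _ _ => hK) (hcont N) (right N le_rfl)
      (fun t ht => hr (Or.inl ⟨t, Set.Ico_subset_Icc_self ht, rfl⟩)) hcM (right M hNM)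
      (fun t ht => hr (Or.inr ⟨t, Set.Ico_subset_Icc_self ht, rfl⟩)) ?_
    rw [hα0, hα0]
  have eq_floor : ∀ (M : ℕ) (s : ℝ), 0 ≤ s → s < M + 1 → α ⌊s⌋₊ s = α M s := by
    intro M s hs hsM
    have hlt : ⌊s⌋₊ < M + 1 := (Nat.floor_lt hs).2 (by exact_mod_cast hsM)
    exact agree _ _ (Nat.lt_succ_iff.1 hlt) ⟨hs, (Nat.lt_floor_add_one s).le⟩
  -- Since `t < ⌊t⌋₊ + 1`, the solution with index `⌊t⌋₊` is still defined slightly beyond `t`, and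
  -- the gluing agrees with it near `t`.
  refine ⟨fun t => α ⌊t⌋₊ t, by simp [hα0], fun t ht => ?_⟩
  have htlt : t < (⌊t⌋₊ : ℝ) + 1 := Nat.lt_floor_add_one t
  have hmem : Set.Icc (0 : ℝ) (⌊t⌋₊ + 1) ∈ 𝓝[Set.Ici 0] t := by
    filter_upwards [self_mem_nhdsWithin, mem_nhdsWithin_of_mem_nhds (Iio_mem_nhds htlt)]
      with s hs hs' using ⟨hs, le_of_lt hs'⟩
  refine ((hα _ t ⟨ht, htlt.le⟩).mono_of_mem_nhdsWithin hmem).congr_of_eventuallyEq ?_ rfl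
  filter_upwards [self_mem_nhdsWithin, mem_nhdsWithin_of_mem_nhds (Iio_mem_nhds htlt)]
    with s hs hs' using eq_floor _ s hs hs'

theorem E3_inner_eq (x y : E3) : inner ℝ x y = x 0 * y 0 + x 1 * y 1 + x 2 * y 2 := by
  simp [PiLp.inner_apply, Fin.sum_univ_three, mul_comm]

theorem matVec_hat_add (x y z : E3) :
    matVec (hat (x + y)) z = matVec (hat x) z + matVec (hat y) z := by
  ext k
  fin_cases k <;> simp [matVec, hat, dotProduct, Fin.sum_univ_three] <;> ring

theorem matVec_hat_sum {ι : Type*} (s : Finset ι) (f : ι → E3) (z : E3) :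
    matVec (hat (∑ j ∈ s, f j)) z = ∑ j ∈ s, matVec (hat (f j)) z := by
  classical
  induction s using Finset.induction_on with
  | empty =>
    ext k
    fin_cases k <;> simp [matVec, hat, dotProduct, Fin.sum_univ_three]
  | insert a s ha ih => rw [Finset.sum_insert ha, Finset.sum_insert ha, matVec_hat_add, ih]

theorem matVec_hat_neg_hat (x y : E3) :
    matVec (hat (-matVec (hat x) y)) x = (inner ℝ x y : ℝ) • x - (inner ℝ x x : ℝ) • y := by
  rw [E3_inner_eq, E3_inner_eq]
  ext k
  fin_cases k <;> simp [matVec, hat, dotProduct, Fin.sum_univ_three] <;> ring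

/-- The polynomial vector field on `(ℝ³)ⁿ` that extends the closed-loop system. -/
noncomputable def ambientField {n : ℕ} (G : Digraph (Fin n)) (x : Fin n → E3) : Fin n → E3 :=
  fun i => ∑ j ∈ neighbors G i, ((inner ℝ (x i) (x j) : ℝ) • x i - (inner ℝ (x i) (x i) : ℝ) • x j)

theorem matVec_hat_angularVelocity {n : ℕ} (G : Digraph (Fin n)) (Γ : State n) (i : Fin n) :
    matVec (hat (angularVelocity G Γ i)) (Γ i) = ambientField G (fun j => (Γ j : E3)) i := by
  rw [angularVelocity, ← Finset.sum_neg_distrib, matVec_hat_sum]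
  exact Finset.sum_congr rfl fun j _ => matVec_hat_neg_hat _ _

theorem inner_ambientField {n : ℕ} (G : Digraph (Fin n)) (x : Fin n → E3) (i : Fin n) :
    inner ℝ (x i) (ambientField G x i) = (0 : ℝ) := by
  rw [ambientField, inner_sum]
  refine Finset.sum_eq_zero fun j _ => ?_
  rw [inner_sub_right, real_inner_smul_right, real_inner_smul_right]
  ring

theorem contDiff_ambientField {n : ℕ} (G : Digraph (Fin n)) : ContDiff ℝ 1 (ambientField G) := by
  refine contDiff_pi.2 fun i => ContDiff.sum fun j _ => ?_
  have h : ∀ k : Fin n, ContDiff ℝ 1 (fun x : Fin n → E3 => x k) := fun k => contDiff_apply ℝ E3 k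
  exact (((h i).inner ℝ (h j)).smul (h i)).sub (((h i).inner ℝ (h i)).smul (h j))

/-- A bounded smooth map that fixes the unit sphere and preserves directions. -/
noncomputable def radialClip (x : E3) : E3 := (2 / (1 + ‖x‖ ^ 2)) • x

theorem contDiff_radialClip : ContDiff ℝ 1 radialClip := by
  refine ContDiff.smul (ContDiff.div contDiff_const (contDiff_const.add (contDiff_norm_sq ℝ)) ?_)
    contDiff_id
  intro x
  positivity

theorem norm_radialClip_le (x : E3) : ‖radialClip x‖ ≤ 1 := by
  have h : (0 : ℝ) < 1 + ‖x‖ ^ 2 := by positivity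
  rw [radialClip, norm_smul, Real.norm_of_nonneg (by positivity), div_mul_eq_mul_div, div_le_one h]
  nlinarith [sq_nonneg (‖x‖ - 1)]

theorem radialClip_of_norm_eq_one {x : E3} (hx : ‖x‖ = 1) : radialClip x = x := by
  rw [radialClip, hx]
  norm_num

/-- Clipping bounds the field. As `clip x i` is a positive multiple of `x i`, the clipped field
stays orthogonal to `x i`; norms are conserved, and on the sphere the clipping has no effect. -/
theorem exists_isTrajectory {n : ℕ} (G : Digraph (Fin n)) (Γ₀ : State n) :
    ∃ γ, IsTrajectory G γ ∧ γ 0 = Γ₀ := by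
  set clip : (Fin n → E3) → (Fin n → E3) := fun x i => radialClip (x i) with hclip
  have hclipC : ContDiff ℝ 1 clip := contDiff_pi.2 fun i =>
    contDiff_radialClip.comp (contDiff_apply ℝ E3 i)
  have hclipN : ∀ x, clip x ∈ Metric.closedBall (0 : Fin n → E3) 1 := by
    intro x
    rw [mem_closedBall_zero_iff, pi_norm_le_iff_of_nonneg zero_le_one]
    exact fun i => norm_radialClip_le _
  obtain ⟨C, hC⟩ := (isCompact_closedBall (0 : Fin n → E3) 1).exists_bound_of_continuousOn
    (contDiff_ambientField G).continuous.continuousOn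
  obtain ⟨α, hα0, hα⟩ := exists_forward_solution_of_contDiff_of_bounded
    (f := fun x => ambientField G (clip x)) ((contDiff_ambientField G).comp hclipC)
    (C := C.toNNReal) (fun x => (hC _ (hclipN x)).trans (Real.le_coe_toNNReal C))
    (fun i => (Γ₀ i : E3))
  have hderiv : ∀ i t, 0 ≤ t → HasDerivWithinAt (fun s => α s i)
      (ambientField G (clip (α t)) i) (Set.Ici 0) t := fun i t ht =>
    hasDerivWithinAt_pi.1 (hα t ht) i
  have horth : ∀ (x : Fin n → E3) i, inner ℝ (x i) (ambientField G (clip x) i) = (0 : ℝ) := by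
    intro x i
    have h := inner_ambientField G (clip x) i
    have hp : (0 : ℝ) < 2 / (1 + ‖x i‖ ^ 2) := by positivity
    have he : clip x i = (2 / (1 + ‖x i‖ ^ 2)) • x i := rfl
    rw [he, real_inner_smul_left] at h
    exact (mul_eq_zero.1 h).resolve_left hp.ne'
  have hnorm : ∀ i t, 0 ≤ t → ‖α t i‖ = 1 := by
    intro i t ht
    have hd : ∀ s ∈ Set.Ici (0 : ℝ),
        HasDerivWithinAt (fun s => (inner ℝ (α s i) (α s i) : ℝ)) 0 (Set.Ici 0) s := by
      intro s hs
      have h := (hderiv i s hs).inner ℝ (hderiv i s hs)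
      rw [← real_inner_comm (ambientField G (clip (α s)) i) (α s i), horth, add_zero] at h
      exact h
    have hconst : (inner ℝ (α t i) (α t i) : ℝ) = inner ℝ (α 0 i) (α 0 i) := by
      refine (convex_Ici (0 : ℝ)).is_const_of_fderivWithin_eq_zero
        (fun s hs => (hd s hs).differentiableWithinAt) (fun s hs => ?_) ht Set.self_mem_Ici
      rw [(hd s hs).hasFDerivWithinAt.fderivWithin (uniqueDiffOn_Ici 0 s hs)]
      ext
      simp
    have h1 : ‖(Γ₀ i : E3)‖ = 1 := by simp
    rw [real_inner_self_eq_norm_sq, real_inner_self_eq_norm_sq, hα0, h1] at hconst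
    nlinarith [norm_nonneg (α t i)]
  refine ⟨fun t => if ht : 0 ≤ t then fun i => ⟨α t i, by simp [hnorm i t ht]⟩ else Γ₀, ?_, ?_⟩
  · intro t ht i
    rw [matVec_hat_angularVelocity]
    have hcl : clip (α t) = α t := funext fun j => radialClip_of_norm_eq_one (hnorm j t ht)
    have h := hderiv i t ht
    rw [hcl] at h
    simp only [ht, dif_pos]
    refine h.congr (fun s hs => ?_) ?_
    · have hs' : (0 : ℝ) ≤ s := hs
      simp [hs']
    · simp [ht]
  · ext1 i
    apply Subtype.ext
    simp [hα0]

/-! ### Real-variable tools: persistence of a minimum and Barbalat's lemma. -/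

/-- A family of functions whose least positive member never decreases keeps its positive lower
bounds. -/
theorem le_of_forall_deriv_nonneg_of_isLeast {ι : Type*} [Finite ι] {f f' : ι → ℝ → ℝ} {m : ℝ}
    (hf : ∀ i t, 0 ≤ t → HasDerivWithinAt (f i) (f' i t) (Set.Ici 0) t)
    (hf' : ∀ i t, 0 ≤ t → 0 ≤ f i t → (∀ j, f i t ≤ f j t) → 0 ≤ f' i t)
    (hm : 0 < m) (h0 : ∀ i, m ≤ f i 0) {T : ℝ} (hT : 0 ≤ T) (i : ι) : m ≤ f i T := by
  -- A barrier of slope `-ε` below `m` makes the comparison strict: a function touching it is the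
  -- least one, hence has derivative `≥ 0 > -ε`. The condition on `ε` keeps the barrier nonnegative,
  -- as `hf'` requires.
  have key : ∀ ε : ℝ, 0 < ε → ε * (1 + T) ≤ m → m - ε * (1 + T) ≤ f i T := by
    intro ε hε hεm
    set h : ℝ → ℝ := fun t => m - ε * (1 + t) with hh
    have hhd : ∀ t, HasDerivAt h (-ε) t := by
      intro t
      have := (((hasDerivAt_id t).const_add 1).const_mul ε).const_sub m
      simpa [hh] using this
    have hcont : ContinuousOn (fun t => fun j => f j t - h t) (Set.Icc 0 T) := by
      refine continuousOn_pi.2 fun j t ht => ?_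
      exact ((hf j t ht.1).continuousWithinAt.mono Set.Icc_subset_Ici_self).sub
        (hhd t).continuousAt.continuousWithinAt
    have hclosed : IsClosed ({t | ∀ j, h t ≤ f j t} ∩ Set.Icc 0 T) := by
      have := hcont.preimage_isClosed_of_isClosed isClosed_Icc
        (isClosed_Ici : IsClosed (Set.Ici (0 : ι → ℝ)))
      convert this using 1
      ext t
      simp [Pi.le_def, and_comm]
    refine hclosed.Icc_subset_of_forall_exists_gt (fun j => ?_) ?_ (Set.right_mem_Icc.2 hT) i
    · have := h0 j
      simp only [hh]
      nlinarith
    · rintro x ⟨hx, hx0, hxT⟩ y hy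
      have hev : ∀ j, ∀ᶠ z in 𝓝[>] x, h z ≤ f j z := by
        intro j
        have hd : HasDerivWithinAt (fun t => f j t - h t) (f' j x - -ε) (Set.Ioi x) x :=
          ((hf j x hx0).mono fun z hz => hx0.trans (le_of_lt hz)).sub (hhd x).hasDerivWithinAt
        rcases (hx j).lt_or_eq with hlt | heq
        · have := hd.continuousWithinAt.eventually (lt_mem_nhds (sub_pos.2 hlt))
          filter_upwards [this] with z hz using (sub_pos.1 hz).le
        · have hpos : 0 < f' j x - -ε := by
            have : 0 ≤ f' j x := by
              refine hf' j x hx0 ?_ fun k => heq ▸ hx k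
              rw [← heq]
              simp only [hh]
              nlinarith
            linarith
          have := (hasDerivWithinAt_iff_tendsto_slope' Set.self_notMem_Ioi).1 hd
          filter_upwards [this.eventually (lt_mem_nhds hpos), self_mem_nhdsWithin] with z hz hxz
          have hxz' : 0 < z - x := sub_pos.2 hxz
          rw [slope_def_field, lt_div_iff₀ hxz', zero_mul] at hz
          linarith
      have hall := (eventually_all.2 hev).and
        (eventually_of_mem (Ioc_mem_nhdsGT hy) fun z hz => hz)
      obtain ⟨z, hz, hzy⟩ := hall.exists
      exact ⟨z, hz, hzy⟩
  refine le_of_forall_pos_sub_le fun η hη => ?_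
  have h1T : 0 < 1 + T := by linarith
  have hmin : 0 < min η m := lt_min hη hm
  have := key (min η m / (1 + T)) (by positivity)
  rw [div_mul_cancel₀ _ h1T.ne'] at this
  linarith [this (min_le_right _ _), min_le_left η m]

theorem monotoneOn_Ici_of_hasDerivWithinAt_nonneg {U q : ℝ → ℝ}
    (hU : ∀ t, 0 ≤ t → HasDerivWithinAt U (q t) (Set.Ici 0) t) (hq : ∀ t, 0 ≤ t → 0 ≤ q t) :
    MonotoneOn U (Set.Ici 0) := by
  refine monotoneOn_of_hasDerivWithinAt_nonneg (convex_Ici 0)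
    (fun t ht => (hU t ht).continuousWithinAt)
    (fun t ht => (hU t (interior_subset ht)).mono interior_subset)
    fun t ht => hq t (interior_subset ht)

/-- Barbalat's lemma for a nondecreasing bounded function. -/
theorem tendsto_deriv_zero_of_uniformContinuousOn {U q : ℝ → ℝ} {B : ℝ}
    (hU : ∀ t, 0 ≤ t → HasDerivWithinAt U (q t) (Set.Ici 0) t) (hq : ∀ t, 0 ≤ t → 0 ≤ q t)
    (hB : ∀ t, 0 ≤ t → U t ≤ B) (huc : UniformContinuousOn q (Set.Ici 0)) :
    Tendsto q atTop (𝓝 0) := by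
  have hmono := monotoneOn_Ici_of_hasDerivWithinAt_nonneg hU hq
  have hVmono : Monotone fun t => U (max t 0) := fun s t hst =>
    hmono (Set.mem_Ici.2 (le_max_right _ _)) (Set.mem_Ici.2 (le_max_right _ _)) (max_le_max_right 0 hst)
  have hlim := tendsto_atTop_ciSup hVmono
    ⟨B, by rintro _ ⟨t, rfl⟩; exact hB _ (le_max_right _ _)⟩
  rw [Metric.tendsto_atTop]
  intro ε hε
  obtain ⟨δ, hδ, huc⟩ := Metric.uniformContinuousOn_iff.1 huc (ε / 2) (by positivity)
  -- `U` converges, so its increments over length `δ / 2` vanish; the mean value theorem finds a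
  -- nearby `ξ` with `q ξ` small, and uniform continuity carries this to `t`.
  have hsmall : Tendsto (fun t => U (max (t + δ / 2) 0) - U (max t 0)) atTop (𝓝 0) := by
    simpa using (hlim.comp (tendsto_atTop_add_const_right atTop (δ / 2) tendsto_id)).sub hlim
  obtain ⟨T, hT⟩ := eventually_atTop.1 (hsmall.eventually (gt_mem_nhds
    (show (0 : ℝ) < δ / 2 * (ε / 2) by positivity)))
  refine ⟨max T 0, fun t ht => ?_⟩
  have ht0 : 0 ≤ t := (le_max_right _ _).trans ht
  have hlt := hT t ((le_max_left _ _).trans ht)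
  rw [max_eq_left ht0, max_eq_left (by positivity)] at hlt
  obtain ⟨ξ, hξ, hslope⟩ := exists_hasDerivAt_eq_slope U q
    (show t < t + δ / 2 by linarith)
    (fun s hs => ((hU s (ht0.trans hs.1)).continuousWithinAt).mono fun r hr => ht0.trans hr.1)
    (fun s hs => (hU s (ht0.trans hs.1.le)).hasDerivAt (Ici_mem_nhds (ht0.trans_lt hs.1)))
  have hξq : q ξ < ε / 2 := by
    rw [hslope, add_sub_cancel_left, div_lt_iff₀ (by positivity)]
    linarith
  have hclose := huc t ht0 ξ (ht0.trans hξ.1.le) (by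
    rw [Real.dist_eq, abs_sub_lt_iff]
    constructor <;> linarith [hξ.1, hξ.2])
  rw [Real.dist_eq, abs_sub_lt_iff] at hclose
  rw [Real.dist_eq, sub_zero, abs_of_nonneg (hq t ht0)]
  linarith [hclose.1]

theorem continuous_inner_state {n : ℕ} (i j : Fin n) :
    Continuous fun Γ : State n => (inner ℝ (Γ i : E3) (Γ j : E3) : ℝ) :=
  (continuous_subtype_val.comp (continuous_apply i)).inner
    (continuous_subtype_val.comp (continuous_apply j))

theorem IsTrajectory.uniformContinuousOn {n : ℕ} {G : Digraph (Fin n)} {γ : ℝ → State n}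
    (hγ : IsTrajectory G γ) : UniformContinuousOn γ (Set.Ici 0) := by
  obtain ⟨C, hC⟩ := (isCompact_closedBall (0 : Fin n → E3) 1).exists_bound_of_continuousOn
    (contDiff_ambientField G).continuous.continuousOn
  have hlip : ∀ i, LipschitzOnWith C.toNNReal (fun t => (γ t i : E3)) (Set.Ici 0) := by
    intro i
    refine (convex_Ici 0).lipschitzOnWith_of_nnnorm_hasDerivWithin_le (hγ · · i) fun t _ => ?_
    rw [matVec_hat_angularVelocity]
    refine (norm_le_pi_norm _ i).trans ((hC _ ?_).trans (Real.le_coe_toNNReal C))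
    rw [mem_closedBall_zero_iff, pi_norm_le_iff_of_nonneg zero_le_one]
    simp
  refine LipschitzOnWith.uniformContinuousOn (K := C.toNNReal) ?_
  refine LipschitzOnWith.of_dist_le_mul fun s hs t ht => ?_
  exact (dist_pi_le_iff (by positivity)).2 fun i => (hlip i).dist_le_mul s hs t ht

/-! ### Neighbour inner products, their rates and the potential. -/

section Ring

variable {n : ℕ} [NeZero n]

/-- The inner product of the agents `i` and `i + 1`. -/
noncomputable def nbrInner (Γ : State n) (i : Fin n) : ℝ := inner ℝ (Γ i : E3) (Γ (i + 1))

/-- Minus the rate of change of `nbrInner Γ i` caused by attention to successors. -/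
noncomputable def succRate (Γ : State n) (i : Fin n) : ℝ :=
  1 - nbrInner Γ i ^ 2 + inner ℝ (Γ i : E3) (Γ (i + 1 + 1)) - nbrInner Γ i * nbrInner Γ (i + 1)

/-- Minus the rate of change of `nbrInner Γ i` caused by attention to predecessors. -/
noncomputable def predRate (Γ : State n) (i : Fin n) : ℝ :=
  1 - nbrInner Γ i ^ 2 + inner ℝ (Γ (i - 1) : E3) (Γ (i + 1)) - nbrInner Γ (i - 1) * nbrInner Γ i

/-- The sine of the angle between the agents `i` and `i + 1`. -/
noncomputable def nbrSin (Γ : State n) (i : Fin n) : ℝ := √(1 - nbrInner Γ i ^ 2)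

/-- The potential `-∑ ⟪Γ_i, Γ_{i+1}⟫`. -/
noncomputable def ringPotential (Γ : State n) : ℝ := ∑ i, -nbrInner Γ i

/-- The dissipation rate of the potential. -/
noncomputable def dissipation (Γ : State n) : ℝ := ∑ i, succRate Γ i

theorem S2_inner_self (x : S2) : inner ℝ (x : E3) (x : E3) = (1 : ℝ) := by
  rw [real_inner_self_eq_norm_sq]
  simp

/-- Cauchy–Schwarz for the components of `x` and `z` orthogonal to `y`. -/
theorem inner_sub_mul_sq_le (x y z : S2) :
    (inner ℝ (x : E3) (z : E3) - inner ℝ (x : E3) (y : E3) * inner ℝ (y : E3) (z : E3)) ^ 2 ≤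
      (1 - inner ℝ (x : E3) (y : E3) ^ 2) * (1 - inner ℝ (y : E3) (z : E3) ^ 2 : ℝ) := by
  have h := real_inner_mul_inner_self_le ((x : E3) - (inner ℝ (x : E3) (y : E3) : ℝ) • (y : E3))
    ((z : E3) - (inner ℝ (y : E3) (z : E3) : ℝ) • (y : E3))
  simp only [inner_sub_left, inner_sub_right, real_inner_smul_left, real_inner_smul_right,
    S2_inner_self, real_inner_comm (x : E3) (y : E3), real_inner_comm (y : E3) (z : E3)] at h
  nlinarith [h]

theorem nbrInner_sq_le_one (Γ : State n) (i : Fin n) : nbrInner Γ i ^ 2 ≤ 1 := by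
  have h := real_inner_mul_inner_self_le (Γ i : E3) (Γ (i + 1))
  rw [S2_inner_self, S2_inner_self] at h
  rw [nbrInner]
  nlinarith

theorem nbrSin_nonneg (Γ : State n) (i : Fin n) : 0 ≤ nbrSin Γ i := Real.sqrt_nonneg _

theorem nbrSin_sq (Γ : State n) (i : Fin n) : nbrSin Γ i ^ 2 = 1 - nbrInner Γ i ^ 2 :=
  Real.sq_sqrt (sub_nonneg.2 (nbrInner_sq_le_one Γ i))

theorem neg_nbrSin_mul_le (Γ : State n) (i : Fin n) :
    -(nbrSin Γ i * nbrSin Γ (i + 1)) ≤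
      inner ℝ (Γ i : E3) (Γ (i + 1 + 1)) - nbrInner Γ i * nbrInner Γ (i + 1) := by
  have h := inner_sub_mul_sq_le (Γ i) (Γ (i + 1)) (Γ (i + 1 + 1))
  refine (abs_le_of_sq_le_sq' ?_ (mul_nonneg (nbrSin_nonneg Γ i) (nbrSin_nonneg Γ (i + 1)))).1
  rw [mul_pow, nbrSin_sq, nbrSin_sq]
  exact h

/-- The defect of equality in the spherical triangle inequality at three consecutive agents. -/
noncomputable def triangleDefect (Γ : State n) (i : Fin n) : ℝ :=
  inner ℝ (Γ i : E3) (Γ (i + 1 + 1)) - nbrInner Γ i * nbrInner Γ (i + 1)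
    + nbrSin Γ i * nbrSin Γ (i + 1)

theorem triangleDefect_nonneg (Γ : State n) (i : Fin n) : 0 ≤ triangleDefect Γ i := by
  have := neg_nbrSin_mul_le Γ i
  rw [triangleDefect]
  linarith

theorem succRate_eq (Γ : State n) (i : Fin n) :
    succRate Γ i = nbrSin Γ i * (nbrSin Γ i - nbrSin Γ (i + 1)) + triangleDefect Γ i := by
  rw [succRate, triangleDefect, ← nbrSin_sq]
  ring

theorem predRate_succ (Γ : State n) (i : Fin n) :
    predRate Γ (i + 1) =
      nbrSin Γ (i + 1) * (nbrSin Γ (i + 1) - nbrSin Γ i) + triangleDefect Γ i := by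
  rw [predRate, triangleDefect, ← nbrSin_sq, add_sub_cancel_right]
  ring

/-- The sums of `s_i²` and `s_{i+1}²` over the ring agree, so `∑ s_i (s_i - s_{i+1})` is half a sum
of squares. -/
theorem dissipation_eq (Γ : State n) :
    dissipation Γ = ∑ i, ((nbrSin Γ i - nbrSin Γ (i + 1)) ^ 2 / 2 + triangleDefect Γ i) := by
  have h : ∑ i, nbrSin Γ (i + 1) ^ 2 = ∑ i, nbrSin Γ i ^ 2 :=
    Equiv.sum_comp (Equiv.addRight (1 : Fin n)) fun i => nbrSin Γ i ^ 2
  have h2 : dissipation Γ - ∑ i, ((nbrSin Γ i - nbrSin Γ (i + 1)) ^ 2 / 2 + triangleDefect Γ i) =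
      ∑ i, (nbrSin Γ i ^ 2 / 2 - nbrSin Γ (i + 1) ^ 2 / 2) := by
    rw [dissipation, ← Finset.sum_sub_distrib]
    refine Finset.sum_congr rfl fun i _ => ?_
    rw [succRate_eq]
    ring
  rw [Finset.sum_sub_distrib, ← Finset.sum_div, ← Finset.sum_div, h, sub_self] at h2
  linarith

theorem sum_predRate (Γ : State n) : ∑ i, predRate Γ i = dissipation Γ := by
  rw [← Equiv.sum_comp (Equiv.addRight (1 : Fin n)), dissipation_eq]
  have h : ∑ i, nbrSin Γ (i + 1) ^ 2 = ∑ i, nbrSin Γ i ^ 2 :=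
    Equiv.sum_comp (Equiv.addRight (1 : Fin n)) fun i => nbrSin Γ i ^ 2
  have h2 : ∑ i, predRate Γ (i + 1) -
      ∑ i, ((nbrSin Γ i - nbrSin Γ (i + 1)) ^ 2 / 2 + triangleDefect Γ i) =
      ∑ i, (nbrSin Γ (i + 1) ^ 2 / 2 - nbrSin Γ i ^ 2 / 2) := by
    rw [← Finset.sum_sub_distrib]
    refine Finset.sum_congr rfl fun i _ => ?_
    rw [predRate_succ]
    ring
  rw [Finset.sum_sub_distrib, ← Finset.sum_div, ← Finset.sum_div, h, sub_self] at h2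
  simp only [Equiv.coe_addRight]
  linarith

theorem dissipation_nonneg (Γ : State n) : 0 ≤ dissipation Γ := by
  rw [dissipation_eq]
  exact Finset.sum_nonneg fun i _ => add_nonneg (by positivity) (triangleDefect_nonneg Γ i)

theorem eq_of_dissipation_eq_zero {Γ : State n} (h : dissipation Γ = 0) (i : Fin n) :
    nbrSin Γ i = nbrSin Γ (i + 1) ∧ triangleDefect Γ i = 0 := by
  rw [dissipation_eq, Finset.sum_eq_zero_iff_of_nonneg
    fun i _ => add_nonneg (by positivity) (triangleDefect_nonneg Γ i)] at h
  have hi := h i (Finset.mem_univ i)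
  have h1 := triangleDefect_nonneg Γ i
  have h2 : 0 ≤ (nbrSin Γ i - nbrSin Γ (i + 1)) ^ 2 / 2 := by positivity
  refine ⟨?_, by linarith⟩
  have h3 : (nbrSin Γ i - nbrSin Γ (i + 1)) ^ 2 = 0 := by linarith
  exact sub_eq_zero.1 (pow_eq_zero_iff two_ne_zero |>.1 h3)

theorem nbrSin_le_of_le {Γ : State n} {i j : Fin n} (hi : 0 ≤ -nbrInner Γ i)
    (hij : -nbrInner Γ i ≤ -nbrInner Γ j) : nbrSin Γ j ≤ nbrSin Γ i := by
  refine Real.sqrt_le_sqrt ?_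
  nlinarith

theorem succRate_nonneg {Γ : State n} {i : Fin n} (hi : 0 ≤ -nbrInner Γ i)
    (hij : ∀ j, -nbrInner Γ i ≤ -nbrInner Γ j) : 0 ≤ succRate Γ i := by
  rw [succRate_eq]
  exact add_nonneg (mul_nonneg (nbrSin_nonneg Γ i) (sub_nonneg.2 (nbrSin_le_of_le hi (hij _))))
    (triangleDefect_nonneg Γ i)

theorem predRate_nonneg {Γ : State n} {i : Fin n} (hi : 0 ≤ -nbrInner Γ i)
    (hij : ∀ j, -nbrInner Γ i ≤ -nbrInner Γ j) : 0 ≤ predRate Γ i := by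
  obtain ⟨k, rfl⟩ : ∃ k, i = k + 1 := ⟨i - 1, (sub_add_cancel i 1).symm⟩
  rw [predRate_succ]
  exact add_nonneg (mul_nonneg (nbrSin_nonneg Γ _) (sub_nonneg.2 (nbrSin_le_of_le hi (hij _))))
    (triangleDefect_nonneg Γ k)

/-- Ensures `i - 1 ≠ i + 1`, so that an undirected ring really has two neighbours per agent. -/
theorem Fin.one_add_one_ne_zero_of_three_le (hn : 3 ≤ n) : (1 + 1 : Fin n) ≠ 0 := by
  obtain ⟨k, rfl⟩ : ∃ k, n = k + 3 := ⟨n - 3, by omega⟩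
  intro h
  have := congrArg Fin.val h
  rw [Fin.val_add] at this
  simp [Nat.mod_eq_of_lt (show 2 < k + 3 by omega)] at this

theorem IsTrajectory.hasDerivWithinAt_nbrInner {G : Digraph (Fin n)} {γ : ℝ → State n}
    (hγ : IsTrajectory G γ) {t : ℝ} (ht : 0 ≤ t) (i : Fin n) :
    HasDerivWithinAt (fun s => nbrInner (γ s) i)
      (inner ℝ (γ t i : E3) (ambientField G (fun j => (γ t j : E3)) (i + 1)) +
        inner ℝ (ambientField G (fun j => (γ t j : E3)) i) (γ t (i + 1) : E3)) (Set.Ici 0) t := by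
  have h1 := hγ t ht i
  have h2 := hγ t ht (i + 1)
  rw [matVec_hat_angularVelocity] at h1 h2
  exact h1.inner ℝ h2

theorem IsDirectedRing.hasDerivWithinAt_neg_nbrInner {G : Digraph (Fin n)} (hG : IsDirectedRing G)
    {γ : ℝ → State n} (hγ : IsTrajectory G γ) {t : ℝ} (ht : 0 ≤ t) (i : Fin n) :
    HasDerivWithinAt (fun s => -nbrInner (γ s) i) (succRate (γ t) i) (Set.Ici 0) t := by
  have h := (hγ.hasDerivWithinAt_nbrInner ht i).neg
  refine h.congr_deriv ?_
  simp only [ambientField, hG i, hG (i + 1), Finset.sum_singleton, inner_sub_left, inner_sub_right,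
    real_inner_smul_left, real_inner_smul_right, S2_inner_self, succRate, nbrInner]
  ring

theorem IsUndirectedRing.hasDerivWithinAt_neg_nbrInner (hn : 3 ≤ n) {G : Digraph (Fin n)}
    (hG : IsUndirectedRing G)
    {γ : ℝ → State n} (hγ : IsTrajectory G γ) {t : ℝ} (ht : 0 ≤ t) (i : Fin n) :
    HasDerivWithinAt (fun s => -nbrInner (γ s) i) (succRate (γ t) i + predRate (γ t) i)
      (Set.Ici 0) t := by
  have h := (hγ.hasDerivWithinAt_nbrInner ht i).neg
  have hne : ∀ k : Fin n, k - 1 ≠ k + 1 := by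
    intro k hk
    refine Fin.one_add_one_ne_zero_of_three_le hn ?_
    rw [sub_eq_iff_eq_add, add_assoc] at hk
    exact left_eq_add.1 hk
  have hG' : neighbors G (i + 1) = {i, i + 1 + 1} := by rw [hG, add_sub_cancel_right]
  have hne' : i ≠ i + 1 + 1 := by simpa using hne (i + 1)
  refine h.congr_deriv ?_
  simp only [ambientField, hG i, hG', Finset.sum_pair (hne i), Finset.sum_pair hne',
    inner_add_left, inner_add_right, inner_sub_left, inner_sub_right,
    sub_add_cancel, real_inner_smul_left, real_inner_smul_right, S2_inner_self, succRate, predRate,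
    nbrInner, real_inner_comm (γ t i : E3) (γ t (i + 1) : E3),
    real_inner_comm (γ t (i - 1) : E3) (γ t i : E3)]
  ring

/-- Treats both graphs at once: `κ = 1` for the undirected ring, `κ = 0` for the directed one. -/
theorem exists_hasDerivWithinAt_neg_nbrInner (hn : 3 ≤ n) {G : Digraph (Fin n)}
    (hG : IsUndirectedRing G ∨ IsDirectedRing G) :
    ∃ κ : ℝ, 0 ≤ κ ∧ ∀ γ : ℝ → State n, IsTrajectory G γ → ∀ t, 0 ≤ t → ∀ i,
      HasDerivWithinAt (fun s => -nbrInner (γ s) i)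
        (succRate (γ t) i + κ * predRate (γ t) i) (Set.Ici 0) t := by
  rcases hG with hG | hG
  · refine ⟨1, zero_le_one, fun γ hγ t ht i => ?_⟩
    rw [one_mul]
    exact hG.hasDerivWithinAt_neg_nbrInner hn hγ ht i
  · refine ⟨0, le_rfl, fun γ hγ t ht i => ?_⟩
    rw [zero_mul, add_zero]
    exact hG.hasDerivWithinAt_neg_nbrInner hγ ht i

/-- Along trajectories, positive lower bounds of all `-⟪Γ_i, Γ_{i+1}⟫` persist. -/
theorem IsTrajectory.le_neg_nbrInner (hn : 3 ≤ n) {G : Digraph (Fin n)}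
    (hG : IsUndirectedRing G ∨ IsDirectedRing G) {γ : ℝ → State n} (hγ : IsTrajectory G γ) {m : ℝ}
    (hm : 0 < m) (h0 : ∀ i, m ≤ -nbrInner (γ 0) i) {t : ℝ} (ht : 0 ≤ t) (i : Fin n) :
    m ≤ -nbrInner (γ t) i := by
  obtain ⟨κ, hκ, hd⟩ := exists_hasDerivWithinAt_neg_nbrInner hn hG
  refine le_of_forall_deriv_nonneg_of_isLeast (f := fun i s => -nbrInner (γ s) i)
    (fun i s hs => hd γ hγ s hs i) (fun i s _ h h' => ?_) hm h0 ht i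
  exact add_nonneg (succRate_nonneg h h') (mul_nonneg hκ (predRate_nonneg h h'))

theorem exists_hasDerivWithinAt_ringPotential (hn : 3 ≤ n) {G : Digraph (Fin n)}
    (hG : IsUndirectedRing G ∨ IsDirectedRing G) :
    ∃ c : ℝ, 1 ≤ c ∧ ∀ γ : ℝ → State n, IsTrajectory G γ → ∀ t, 0 ≤ t →
      HasDerivWithinAt (fun s => ringPotential (γ s)) (c * dissipation (γ t)) (Set.Ici 0) t := by
  obtain ⟨κ, hκ, hd⟩ := exists_hasDerivWithinAt_neg_nbrInner hn hG
  refine ⟨1 + κ, by linarith, fun γ hγ t ht => ?_⟩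
  have h := HasDerivWithinAt.fun_sum (u := Finset.univ) fun i _ => hd γ hγ t ht i
  refine h.congr_deriv ?_
  rw [Finset.sum_add_distrib, ← Finset.mul_sum, sum_predRate, ← dissipation]
  ring

theorem IsTrajectory.monotoneOn_ringPotential (hn : 3 ≤ n) {G : Digraph (Fin n)}
    (hG : IsUndirectedRing G ∨ IsDirectedRing G) {γ : ℝ → State n} (hγ : IsTrajectory G γ) :
    MonotoneOn (fun t => ringPotential (γ t)) (Set.Ici 0) := by
  obtain ⟨c, hc, hd⟩ := exists_hasDerivWithinAt_ringPotential hn hG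
  exact monotoneOn_Ici_of_hasDerivWithinAt_nonneg (hd γ hγ)
    fun t _ => mul_nonneg (by linarith) (dissipation_nonneg _)

theorem continuous_nbrInner (i : Fin n) : Continuous fun Γ : State n => nbrInner Γ i :=
  continuous_inner_state i (i + 1)

theorem continuous_ringPotential : Continuous (ringPotential : State n → ℝ) :=
  continuous_finsetSum _ fun i _ => (continuous_nbrInner i).neg

theorem continuous_dissipation : Continuous (dissipation : State n → ℝ) :=
  continuous_finsetSum _ fun i _ =>
    (((continuous_const.sub ((continuous_nbrInner i).pow 2)).add (continuous_inner_state i _)).sub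
      ((continuous_nbrInner i).mul (continuous_nbrInner _)))

theorem ringPotential_le (Γ : State n) : ringPotential Γ ≤ n := by
  have h : ringPotential Γ ≤ ∑ _i : Fin n, (1 : ℝ) :=
    Finset.sum_le_sum fun i _ => by nlinarith [nbrInner_sq_le_one Γ i]
  simpa using h

theorem IsTrajectory.tendsto_dissipation (hn : 3 ≤ n) {G : Digraph (Fin n)}
    (hG : IsUndirectedRing G ∨ IsDirectedRing G) {γ : ℝ → State n} (hγ : IsTrajectory G γ) :
    Tendsto (fun t => dissipation (γ t)) atTop (𝓝 0) := by
  obtain ⟨c, hc, hd⟩ := exists_hasDerivWithinAt_ringPotential hn hG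
  have huc : UniformContinuousOn (fun t => c * dissipation (γ t)) (Set.Ici 0) :=
    (CompactSpace.uniformContinuous_of_continuous
      (continuous_const.mul continuous_dissipation)).comp_uniformContinuousOn
        hγ.uniformContinuousOn
  have h := tendsto_deriv_zero_of_uniformContinuousOn (hd γ hγ)
    (fun t _ => mul_nonneg (by linarith) (dissipation_nonneg _)) (fun t _ => ringPotential_le _) huc
  have h2 := h.const_mul c⁻¹
  simpa [inv_mul_cancel_left₀ (show c ≠ 0 by linarith)] using h2

end Ring

/-! ### Rotations and the description of cyclic formations by cosines and sines. -/

theorem inner_matVec_hat_self (u x : E3) : inner ℝ x (matVec (hat u) x) = (0 : ℝ) := by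
  rw [E3_inner_eq]
  simp [matVec, hat, dotProduct, Fin.sum_univ_three]
  ring

theorem inner_matVec_hat_self_left (u x : E3) : inner ℝ u (matVec (hat u) x) = (0 : ℝ) := by
  rw [E3_inner_eq]
  simp [matVec, hat, dotProduct, Fin.sum_univ_three]
  ring

theorem matVec_hat_matVec_hat (u x : E3) :
    matVec (hat u) (matVec (hat u) x) = (inner ℝ u x : ℝ) • u - (inner ℝ u u : ℝ) • x := by
  rw [E3_inner_eq, E3_inner_eq]
  ext k
  fin_cases k <;> simp [matVec, hat, dotProduct, Fin.sum_univ_three] <;> ring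

theorem matVec_hat_cross (v w : E3) :
    matVec (hat (matVec (hat v) w)) v = (inner ℝ v v : ℝ) • w - (inner ℝ v w : ℝ) • v := by
  rw [E3_inner_eq, E3_inner_eq]
  ext k
  fin_cases k <;> simp [matVec, hat, dotProduct, Fin.sum_univ_three] <;> ring

theorem inner_matVec_hat_matVec_hat (v w : E3) :
    inner ℝ (matVec (hat v) w) (matVec (hat v) w) =
      (inner ℝ v v * inner ℝ w w - inner ℝ v w ^ 2 : ℝ) := by
  simp only [E3_inner_eq]
  simp [matVec, hat, dotProduct, Fin.sum_univ_three]
  ring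

theorem matVec_add (A : Matrix (Fin 3) (Fin 3) ℝ) (x y : E3) :
    matVec A (x + y) = matVec A x + matVec A y := by
  simp [matVec, Matrix.mulVec_add]

theorem matVec_smul (A : Matrix (Fin 3) (Fin 3) ℝ) (c : ℝ) (x : E3) :
    matVec A (c • x) = c • matVec A x := by
  simp [matVec, Matrix.mulVec_smul]

theorem matVec_mul (A B : Matrix (Fin 3) (Fin 3) ℝ) (x : E3) :
    matVec (A * B) x = matVec A (matVec B x) := by
  simp [matVec]

theorem matVec_sub (A : Matrix (Fin 3) (Fin 3) ℝ) (x y : E3) :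
    matVec A (x - y) = matVec A x - matVec A y := by
  simp [matVec, Matrix.mulVec_sub]

section MatrixNorm

attribute [local instance] Matrix.linftyOpNormedRing Matrix.linftyOpNormedAlgebra

theorem hasDerivAt_matVec_exp_smul (A : Matrix (Fin 3) (Fin 3) ℝ) (v : E3) (t : ℝ) :
    HasDerivAt (fun s : ℝ => matVec (NormedSpace.exp (s • A)) v)
      (matVec A (matVec (NormedSpace.exp (t • A)) v)) t := by
  let ev : Matrix (Fin 3) (Fin 3) ℝ →ₗ[ℝ] E3 :=
    { toFun := fun M => matVec M v
      map_add' := fun M N => by simp [matVec, Matrix.add_mulVec]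
      map_smul' := fun c M => by simp [matVec, Matrix.smul_mulVec] }
  have h := hasDerivAt_exp_smul_const' A t
  have h2 := (LinearMap.toContinuousLinearMap ev).hasFDerivAt.comp_hasDerivAt t h
  rw [← matVec_mul]
  exact h2

end MatrixNorm

/-- Rodrigues' rotation formula for a vector orthogonal to the axis. -/
theorem matVec_exp_smul_hat {u v : E3} (hu : inner ℝ u u = (1 : ℝ)) (huv : inner ℝ u v = (0 : ℝ))
    (t : ℝ) : matVec (NormedSpace.exp (t • hat u)) v =
      Real.cos t • v + Real.sin t • matVec (hat u) v := by
  -- The difference of the two sides solves `h' = u × h` with `h 0 = 0`; skew-symmetry conserves its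
  -- norm.
  set h : ℝ → E3 := fun s => matVec (NormedSpace.exp (s • hat u)) v -
    (Real.cos s • v + Real.sin s • matVec (hat u) v) with hh
  have hd : ∀ s, HasDerivAt h (matVec (hat u) (h s)) s := by
    intro s
    have h1 := (hasDerivAt_matVec_exp_smul (hat u) v s).sub
      (((Real.hasDerivAt_cos s).smul_const v).add
        ((Real.hasDerivAt_sin s).smul_const (matVec (hat u) v)))
    refine h1.congr_deriv ?_
    simp only [hh]
    rw [matVec_sub, matVec_add, matVec_smul, matVec_smul, matVec_hat_matVec_hat, huv, hu]
    module
  have hconst : ∀ s r, (inner ℝ (h s) (h s) : ℝ) = inner ℝ (h r) (h r) := by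
    refine is_const_of_deriv_eq_zero
      (fun s => ((hd s).inner ℝ (hd s)).differentiableAt) fun s => ?_
    rw [((hd s).inner ℝ (hd s)).deriv, real_inner_comm (h s), inner_matVec_hat_self, add_zero]
  have h0 : h 0 = 0 := by simp [hh, matVec]
  have h1 := hconst t 0
  rw [h0, inner_zero_left, inner_self_eq_zero] at h1
  exact sub_eq_zero.1 h1

/-- The two descriptions are related by `w = u × v` and `u = v × w`. -/
theorem mem_cyclicFormation_iff {n : ℕ} {Γ : State n} :
    Γ ∈ cyclicFormation n ↔ ∃ v w : S2, inner ℝ (v : E3) (w : E3) = (0 : ℝ) ∧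
      ∀ i : Fin n, (Γ i : E3) = Real.cos ((i : ℕ) * (Real.pi - Real.pi / n)) • (v : E3) +
        Real.sin ((i : ℕ) * (Real.pi - Real.pi / n)) • (w : E3) := by
  have unit : ∀ v w : S2, inner ℝ (v : E3) (w : E3) = (0 : ℝ) →
      matVec (hat v) w ∈ Metric.sphere (0 : E3) 1 := by
    intro v w hvw
    have h := inner_matVec_hat_matVec_hat (v : E3) w
    rw [S2_inner_self, S2_inner_self, hvw, real_inner_self_eq_norm_sq] at h
    rw [mem_sphere_zero_iff_norm]
    nlinarith [norm_nonneg (matVec (hat (v : E3)) w)]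
  constructor
  · rintro ⟨u, v, huv, h⟩
    refine ⟨v, ⟨_, unit u v huv⟩, inner_matVec_hat_self _ _, fun i => ?_⟩
    rw [h i, matVec_exp_smul_hat (S2_inner_self u) huv]
  · rintro ⟨v, w, hvw, h⟩
    have horth : inner ℝ (matVec (hat (v : E3)) w) (v : E3) = (0 : ℝ) := by
      rw [real_inner_comm, inner_matVec_hat_self_left]
    refine ⟨⟨_, unit v w hvw⟩, v, horth, fun i => ?_⟩
    rw [h i, matVec_exp_smul_hat (S2_inner_self ⟨_, unit v w hvw⟩) horth, matVec_hat_cross,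
      S2_inner_self, hvw]
    simp

theorem inner_cos_smul_add_sin_smul {v w : S2} (hvw : inner ℝ (v : E3) (w : E3) = (0 : ℝ))
    (α β : ℝ) :
    inner ℝ (Real.cos α • (v : E3) + Real.sin α • (w : E3))
      (Real.cos β • (v : E3) + Real.sin β • (w : E3)) = Real.cos (α - β) := by
  have hwv : inner ℝ (w : E3) (v : E3) = (0 : ℝ) := by rw [real_inner_comm, hvw]
  simp only [inner_add_left, inner_add_right, real_inner_smul_left, real_inner_smul_right,
    S2_inner_self, hvw, hwv, Real.cos_sub]
  ring

theorem cyclicFormation_nonempty (n : ℕ) : (cyclicFormation n).Nonempty := by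
  let v : S2 := ⟨EuclideanSpace.single 0 1, by simp⟩
  let w : S2 := ⟨EuclideanSpace.single 1 1, by simp⟩
  have hvw : inner ℝ (v : E3) (w : E3) = (0 : ℝ) := by
    rw [E3_inner_eq]
    simp [v, w]
  refine ⟨fun i => ⟨Real.cos ((i : ℕ) * (Real.pi - Real.pi / n)) • (v : E3) +
    Real.sin ((i : ℕ) * (Real.pi - Real.pi / n)) • (w : E3), ?_⟩,
    mem_cyclicFormation_iff.2 ⟨v, w, hvw, fun i => rfl⟩⟩
  have h := inner_cos_smul_add_sin_smul hvw ((i : ℕ) * (Real.pi - Real.pi / n))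
    ((i : ℕ) * (Real.pi - Real.pi / n))
  rw [sub_self, Real.cos_zero, real_inner_self_eq_norm_sq] at h
  rw [mem_sphere_zero_iff_norm]
  exact (pow_eq_one_iff_of_nonneg (norm_nonneg _) two_ne_zero).1 h

/-! ### Classification of the states without dissipation. -/

section Ring

variable {n : ℕ} [NeZero n]

theorem nbrInner_of_mem_cyclicFormation (hn : 3 ≤ n) (hodd : Odd n) {Γ : State n}
    (hΓ : Γ ∈ cyclicFormation n) (i : Fin n) : -nbrInner Γ i = Real.cos (Real.pi / n) := by
  obtain ⟨v, w, hvw, h⟩ := mem_cyclicFormation_iff.1 hΓ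
  rw [nbrInner, h, h, inner_cos_smul_add_sin_smul hvw]
  by_cases hi : (i : ℕ) + 1 < n
  · rw [Fin.val_add_one_of_lt' hi, show ((i : ℕ) : ℝ) * (Real.pi - Real.pi / n) -
      ((i + 1 : ℕ) : ℝ) * (Real.pi - Real.pi / n) = -(Real.pi - Real.pi / n) by push_cast; ring,
      Real.cos_neg, Real.cos_pi_sub, neg_neg]
  -- The closing edge joins index `n - 1 = 2k` to `0`; as `n` is odd, its angle is `π/n - π` modulo
  -- `2π`, so its cosine matches that of the other edges.
  · have hin : (i : ℕ) + 1 = n := le_antisymm i.2 (not_lt.1 hi)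
    obtain ⟨k, hk⟩ := hodd
    have h0 : ((i + 1 : Fin n) : ℕ) = 0 := by
      have h1 : (1 : ℕ) % n = 1 := Nat.mod_eq_of_lt (by omega)
      rw [Fin.val_add, Fin.val_one', h1, hin, Nat.mod_self]
    have hik : ((i : ℕ) : ℝ) = 2 * k := by
      have : (i : ℕ) = 2 * k := by omega
      exact_mod_cast this
    have hnk : (n : ℝ) = 2 * k + 1 := by exact_mod_cast hk
    have hk0 : (2 * k + 1 : ℝ) ≠ 0 := by positivity
    rw [h0, hik, hnk, show (2 * k : ℝ) * (Real.pi - Real.pi / (2 * k + 1)) -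
      ((0 : ℕ) : ℝ) * (Real.pi - Real.pi / (2 * k + 1)) =
      Real.pi / (2 * k + 1) - Real.pi + k * (2 * Real.pi) by push_cast; field_simp; ring,
      Real.cos_add_nat_mul_two_pi, Real.cos_sub_pi, neg_neg]

theorem Fin.forall_eq_zero_of_forall_eq_add_one {α : Type*} {f : Fin n → α}
    (h : ∀ i, f i = f (i + 1)) (i : Fin n) : f i = f 0 := by
  have hk : ∀ k : ℕ, f (Fin.ofNat n k) = f 0 := by
    intro k
    induction k with
    | zero => rfl
    | succ k ih =>
      rw [← ih, h (Fin.ofNat n k)]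
      congr 1
      ext
      simp [Fin.val_add]
  have := hk i
  rwa [Fin.ofNat_val_eq_self] at this

/-- Zero defect and equal angles fix all inner products of the three points, and the difference of
the two sides turns out to have norm zero. -/
theorem add_eq_smul_of_triangleDefect_eq_zero {Γ : State n} {i : Fin n}
    (h : triangleDefect Γ i = 0) (ha : nbrInner Γ (i + 1) = nbrInner Γ i) :
    (Γ (i + 1 + 1) : E3) = (2 * nbrInner Γ i) • (Γ (i + 1) : E3) - (Γ i : E3) := by
  have hs : nbrSin Γ (i + 1) = nbrSin Γ i := by rw [nbrSin, nbrSin, ha]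
  rw [triangleDefect, hs, ← sq, nbrSin_sq, ha] at h
  have hb : inner ℝ (Γ i : E3) (Γ (i + 1 + 1)) = 2 * nbrInner Γ i ^ 2 - 1 := by linarith
  have h1 : inner ℝ (Γ i : E3) (Γ (i + 1)) = nbrInner Γ i := rfl
  have h2 : inner ℝ (Γ (i + 1) : E3) (Γ (i + 1 + 1)) = nbrInner Γ i := ha
  have hz : inner ℝ ((Γ (i + 1 + 1) : E3) - ((2 * nbrInner Γ i) • (Γ (i + 1) : E3) - (Γ i : E3)))
      ((Γ (i + 1 + 1) : E3) - ((2 * nbrInner Γ i) • (Γ (i + 1) : E3) - (Γ i : E3))) = (0 : ℝ) := by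
    simp only [inner_sub_left, inner_sub_right, real_inner_smul_left, real_inner_smul_right,
      S2_inner_self, h1, h2, hb, real_inner_comm (Γ i : E3) (Γ (i + 1) : E3),
      real_inner_comm (Γ (i + 1) : E3) (Γ (i + 1 + 1) : E3),
      real_inner_comm (Γ i : E3) (Γ (i + 1 + 1) : E3)]
    ring
  exact sub_eq_zero.1 (inner_self_eq_zero.1 hz)

/-- The solutions of the recurrence of equally spaced points on a great circle. -/
theorem eq_cos_smul_add_sin_smul_of_recurrence {x : ℕ → E3} {φ : ℝ} {w : E3}
    (h1 : x 1 = Real.cos φ • x 0 + Real.sin φ • w)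
    (hx : ∀ k, x (k + 2) = (2 * Real.cos φ) • x (k + 1) - x k) (k : ℕ) :
    x k = Real.cos (k * φ) • x 0 + Real.sin (k * φ) • w := by
  induction k using Nat.twoStepInduction with
  | zero => simp
  | one => simpa using h1
  | more k ih1 ih2 =>
    have hc : Real.cos ((k + 2 : ℕ) * φ) =
        2 * Real.cos φ * Real.cos ((k + 1 : ℕ) * φ) - Real.cos (k * φ) := by
      rw [show ((k + 2 : ℕ) : ℝ) * φ = (k + 1 : ℕ) * φ + φ by push_cast; ring,
        show (k : ℝ) * φ = (k + 1 : ℕ) * φ - φ by push_cast; ring, Real.cos_add, Real.cos_sub]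
      ring
    have hs : Real.sin ((k + 2 : ℕ) * φ) =
        2 * Real.cos φ * Real.sin ((k + 1 : ℕ) * φ) - Real.sin (k * φ) := by
      rw [show ((k + 2 : ℕ) : ℝ) * φ = (k + 1 : ℕ) * φ + φ by push_cast; ring,
        show (k : ℝ) * φ = (k + 1 : ℕ) * φ - φ by push_cast; ring, Real.sin_add, Real.sin_sub]
      ring
    rw [hx, ih1, ih2, hc, hs]
    module

/-- `n θ = (n - 2k) π`, where `n - 2k` is odd and lies strictly between `0` and `3`. -/
theorem eq_pi_div_of_cos_mul_eq_one (hodd : Odd n) {θ : ℝ} (hθ : 0 < θ)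
    (hθ3 : θ < 3 * Real.pi / n) (h : Real.cos (n * (Real.pi - θ)) = 1) : θ = Real.pi / n := by
  have hn0 : (0 : ℝ) < n := Nat.cast_pos.2 (NeZero.pos n)
  obtain ⟨k, hk⟩ := (Real.cos_eq_one_iff _).1 h
  have heq : n * θ = ((n - 2 * k : ℤ) : ℝ) * Real.pi := by
    push_cast
    linarith
  have hlt : n * θ < 3 * Real.pi := by
    rw [lt_div_iff₀ hn0] at hθ3
    linarith
  have h1 : (0 : ℤ) < n - 2 * k := by
    have : (0 : ℝ) < ((n - 2 * k : ℤ) : ℝ) :=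
      pos_of_mul_pos_left (heq ▸ mul_pos hn0 hθ) Real.pi_pos.le
    exact_mod_cast this
  have h2 : (n - 2 * k : ℤ) < 3 := by
    have : ((n - 2 * k : ℤ) : ℝ) < 3 := lt_of_mul_lt_mul_right (heq ▸ hlt) Real.pi_pos.le
    exact_mod_cast this
  obtain ⟨j, hj⟩ := hodd
  have h3 : (n - 2 * k : ℤ) = 1 := by omega
  rw [h3, Int.cast_one, one_mul] at heq
  rw [eq_div_iff hn0.ne', mul_comm, heq]

/-- States without dissipation whose neighbours are far apart are cyclic formations. -/
theorem mem_cyclicFormation_of_dissipation_eq_zero (hodd : Odd n) {Γ : State n}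
    (hpos : ∀ i, 0 < -nbrInner Γ i) (hcos : ∀ i, Real.cos (3 * Real.pi / n) < -nbrInner Γ i)
    (h : dissipation Γ = 0) : Γ ∈ cyclicFormation n := by
  set a := nbrInner Γ 0 with ha_def
  have hS := Fin.forall_eq_zero_of_forall_eq_add_one fun i => (eq_of_dissipation_eq_zero h i).1
  have ha : ∀ i, nbrInner Γ i = a := by
    intro i
    have h1 := nbrSin_sq Γ i
    rw [hS i, nbrSin_sq] at h1
    have h2 : nbrInner Γ i ^ 2 = a ^ 2 := by linarith
    rcases sq_eq_sq_iff_eq_or_eq_neg.1 h2 with h3 | h3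
    · exact h3
    · linarith [hpos i, hpos 0]
  have ha0 : 0 < -a := hpos 0
  have ha1 : -a ≤ 1 := by nlinarith [nbrInner_sq_le_one Γ 0]
  set x : ℕ → E3 := fun k => Γ (Fin.ofNat n k) with hx_def
  have hsucc : ∀ k, Fin.ofNat n (k + 1) = Fin.ofNat n k + 1 := by
    intro k
    ext
    simp [Fin.val_add]
  have hxn : x n = x 0 := by
    have : Fin.ofNat n n = Fin.ofNat n 0 := by
      ext
      simp
    simp only [hx_def, this]
  have hx0 : inner ℝ (x 0) (x 0) = (1 : ℝ) := S2_inner_self _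
  have hx01 : ∀ k, inner ℝ (x k) (x (k + 1)) = a := by
    intro k
    simp only [hx_def, hsucc]
    exact ha _
  have hrec : ∀ k, x (k + 2) = (2 * a) • x (k + 1) - x k := by
    intro k
    simp only [hx_def, hsucc]
    have := add_eq_smul_of_triangleDefect_eq_zero (eq_of_dissipation_eq_zero h
      (Fin.ofNat n k)).2 (by rw [ha, ha])
    rwa [ha] at this
  rcases ha1.eq_or_lt with ha1 | ha1
  · exfalso
    have hneg : ∀ k, x (k + 1) = -x k := by
      intro k
      have hz : inner ℝ (x (k + 1) + x k) (x (k + 1) + x k) = (0 : ℝ) := by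
        rw [real_inner_add_add_self, real_inner_comm (x k), hx01, S2_inner_self, S2_inner_self]
        linarith
      exact eq_neg_of_add_eq_zero_left (inner_self_eq_zero.1 hz)
    have hpow : ∀ k, x k = (-1 : ℝ) ^ k • x 0 := by
      intro k
      induction k with
      | zero => simp
      | succ k ih => rw [hneg, ih, pow_succ]; module
    have hz := hpow n
    rw [hxn, hodd.neg_one_pow, neg_one_smul] at hz
    have h1 := hx0
    rw [hz, inner_neg_right, ← hz, hx0] at h1
    norm_num at h1
  set θ := Real.arccos (-a) with hθ_def
  have hcosθ : Real.cos θ = -a := Real.cos_arccos (by linarith) ha1.le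
  have hcosφ : Real.cos (Real.pi - θ) = a := by rw [Real.cos_pi_sub, hcosθ, neg_neg]
  have hθpos : 0 < θ := Real.arccos_pos.2 ha1
  have hθpi : θ < Real.pi := by
    have := Real.arccos_lt_pi_div_two.2 ha0
    linarith [Real.pi_pos]
  have hn0 : (0 : ℝ) < n := Nat.cast_pos.2 (NeZero.pos n)
  have hθ3 : θ < 3 * Real.pi / n := by
    by_contra hcon
    have := Real.cos_le_cos_of_nonneg_of_le_pi (by positivity) hθpi.le (not_lt.1 hcon)
    rw [hcosθ] at this
    exact absurd this (not_le.2 (hcos 0))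
  have hsin : 0 < Real.sin (Real.pi - θ) :=
    Real.sin_pos_of_pos_of_lt_pi (by linarith) (by linarith)
  have hsin2 : Real.sin (Real.pi - θ) ^ 2 = 1 - a ^ 2 := by rw [Real.sin_sq, hcosφ]
  set w : E3 := (Real.sin (Real.pi - θ))⁻¹ • (x 1 - a • x 0) with hw_def
  have hx1 : x 1 = Real.cos (Real.pi - θ) • x 0 + Real.sin (Real.pi - θ) • w := by
    rw [hw_def, smul_inv_smul₀ hsin.ne', hcosφ]
    abel
  have hform := eq_cos_smul_add_sin_smul_of_recurrence hx1 (by rwa [hcosφ])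
  have hx11 : inner ℝ (x 1) (x 1) = (1 : ℝ) := S2_inner_self _
  have hvw : inner ℝ (x 0) w = (0 : ℝ) := by
    rw [hw_def, real_inner_smul_right, inner_sub_right, real_inner_smul_right, hx01, hx0]
    ring
  have hww : ‖w‖ = 1 := by
    have h1 : inner ℝ (x 1 - a • x 0) (x 1 - a • x 0) = (1 - a ^ 2 : ℝ) := by
      simp only [inner_sub_left, inner_sub_right, real_inner_smul_left, real_inner_smul_right,
        hx11, hx0, hx01, real_inner_comm (x 0) (x 1)]
      ring
    have h2 : ‖w‖ ^ 2 = 1 := by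
      rw [← real_inner_self_eq_norm_sq, hw_def, real_inner_smul_left, real_inner_smul_right, h1,
        ← hsin2]
      field_simp
    exact (pow_eq_one_iff_of_nonneg (norm_nonneg _) two_ne_zero).1 h2
  have hcosn : Real.cos (n * (Real.pi - θ)) = 1 := by
    have h1 := congrArg (fun y => (inner ℝ (x 0) y : ℝ)) (hform n)
    simp only [hxn, inner_add_right, real_inner_smul_right, hx0, hvw] at h1
    linarith
  have hθn := eq_pi_div_of_cos_mul_eq_one hodd hθpos hθ3 hcosn
  refine mem_cyclicFormation_iff.2 ⟨Γ (Fin.ofNat n 0), ⟨w, by simpa using hww⟩, hvw, fun i => ?_⟩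
  have h1 := hform i
  rw [hθn] at h1
  simp only [hx_def, Fin.ofNat_val_eq_self] at h1
  exact h1

end Ring

/-! ### Geodesic distances and the distance to a set of states. -/

theorem S2_inner_mem_Icc (x y : S2) : inner ℝ (x : E3) (y : E3) ∈ Set.Icc (-1 : ℝ) 1 := by
  have h := abs_real_inner_le_norm (x : E3) (y : E3)
  rw [norm_eq_of_mem_sphere, norm_eq_of_mem_sphere, one_mul] at h
  exact abs_le.1 h

theorem geoDist_nonneg (x y : S2) : 0 ≤ geoDist x y := Real.arccos_nonneg _

theorem geoDist_self (x : S2) : geoDist x x = 0 := by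
  rw [geoDist, S2_inner_self, Real.arccos_one]

theorem norm_sub_le_geoDist (x y : S2) : ‖(x : E3) - y‖ ≤ geoDist x y := by
  have h := Real.one_sub_sq_div_two_le_cos (x := geoDist x y)
  rw [geoDist, Real.cos_arccos (S2_inner_mem_Icc x y).1 (S2_inner_mem_Icc x y).2, ← geoDist] at h
  have h2 := norm_sub_sq_real (x : E3) y
  rw [norm_eq_of_mem_sphere, norm_eq_of_mem_sphere] at h2
  exact abs_le_of_sq_le_sq' (by linarith) (geoDist_nonneg x y) |>.2

theorem continuous_geoDist_left (y : S2) : Continuous fun x => geoDist x y :=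
  Real.continuous_arccos.comp (continuous_subtype_val.inner continuous_const)

theorem geoDist_le_stateDist {n : ℕ} (Γ Δ : State n) (i : Fin n) :
    geoDist (Γ i) (Δ i) ≤ stateDist Γ Δ :=
  le_ciSup (f := fun i => geoDist (Γ i) (Δ i)) (Set.finite_range _).bddAbove i

theorem stateDist_nonneg {n : ℕ} (Γ Δ : State n) : 0 ≤ stateDist Γ Δ :=
  Real.iSup_nonneg fun _ => geoDist_nonneg _ _

theorem distTo_nonneg {n : ℕ} (M : Set (State n)) (Γ : State n) : 0 ≤ distTo M Γ :=
  Real.iInf_nonneg fun _ => stateDist_nonneg _ _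

theorem distTo_le_stateDist {n : ℕ} {M : Set (State n)} (Γ : State n) {Δ : State n}
    (hΔ : Δ ∈ M) : distTo M Γ ≤ stateDist Γ Δ :=
  ciInf_le (f := fun Δ : M => stateDist Γ (Δ : State n))
    ⟨0, by rintro _ ⟨Δ, rfl⟩; exact stateDist_nonneg _ _⟩ ⟨Δ, hΔ⟩

/-- Provides a threshold `m` that cyclic formations exceed strictly, so that nearby states exceed it
too. -/
theorem exists_between_cos {n : ℕ} (hn : 3 ≤ n) :
    ∃ m : ℝ, 0 < m ∧ Real.cos (3 * Real.pi / n) < m ∧ m < Real.cos (Real.pi / n) := by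
  have hn3 : (3 : ℝ) ≤ n := by exact_mod_cast hn
  have hn0 : (0 : ℝ) < n := by linarith
  have hpi := Real.pi_pos
  have h3 : 3 * Real.pi / n ≤ Real.pi := by
    rw [div_le_iff₀ hn0]
    nlinarith
  have h1 : 0 < Real.pi / n := by positivity
  have h31 : 3 * Real.pi / n = 3 * (Real.pi / n) := by ring
  have hpos : 0 < Real.cos (Real.pi / n) :=
    Real.cos_pos_of_mem_Ioo ⟨by linarith, by linarith⟩
  have hlt : Real.cos (3 * Real.pi / n) < Real.cos (Real.pi / n) :=
    Real.cos_lt_cos_of_nonneg_of_le_pi h1.le h3 (by linarith)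
  obtain ⟨m, hm1, hm2⟩ := exists_between (max_lt hpos hlt)
  exact ⟨m, (le_max_left _ _).trans_lt hm1, (le_max_right _ _).trans_lt hm1, hm2⟩

section Ring

variable {n : ℕ} [NeZero n]

theorem abs_nbrInner_sub_le (Γ Δ : State n) (i : Fin n) :
    |nbrInner Γ i - nbrInner Δ i| ≤ 2 * stateDist Γ Δ := by
  have h : nbrInner Γ i - nbrInner Δ i = inner ℝ ((Γ i : E3) - Δ i) (Γ (i + 1) : E3) +
      inner ℝ (Δ i : E3) ((Γ (i + 1) : E3) - Δ (i + 1)) := by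
    rw [inner_sub_left, inner_sub_right, nbrInner, nbrInner]
    ring
  have h1 := abs_real_inner_le_norm ((Γ i : E3) - Δ i) (Γ (i + 1) : E3)
  have h2 := abs_real_inner_le_norm (Δ i : E3) ((Γ (i + 1) : E3) - Δ (i + 1))
  rw [norm_eq_of_mem_sphere, mul_one] at h1
  rw [norm_eq_of_mem_sphere, one_mul] at h2
  have h3 := (norm_sub_le_geoDist (Γ i) (Δ i)).trans (geoDist_le_stateDist Γ Δ i)
  have h4 := (norm_sub_le_geoDist (Γ (i + 1)) (Δ (i + 1))).trans (geoDist_le_stateDist Γ Δ _)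
  rw [h]
  exact (abs_add_le _ _).trans (by linarith)

theorem abs_neg_nbrInner_sub_cos_le (hn : 3 ≤ n) (hodd : Odd n) {Γ : State n} {δ : ℝ}
    (hΓ : distTo (cyclicFormation n) Γ < δ) (i : Fin n) :
    |-nbrInner Γ i - Real.cos (Real.pi / n)| ≤ 2 * δ := by
  have : Nonempty (cyclicFormation n) := (cyclicFormation_nonempty n).to_subtype
  obtain ⟨⟨Δ, hΔ⟩, hlt⟩ := exists_lt_of_ciInf_lt hΓ
  rw [← nbrInner_of_mem_cyclicFormation hn hodd hΔ i, neg_sub_neg, abs_sub_comm]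
  exact (abs_nbrInner_sub_le Γ Δ i).trans (by linarith)

theorem abs_ringPotential_sub_le (hn : 3 ≤ n) (hodd : Odd n) {Γ : State n} {δ : ℝ}
    (hΓ : distTo (cyclicFormation n) Γ < δ) :
    |ringPotential Γ - n * Real.cos (Real.pi / n)| ≤ n * (2 * δ) := by
  have h : ringPotential Γ - n * Real.cos (Real.pi / n) =
      ∑ i, (-nbrInner Γ i - Real.cos (Real.pi / n)) := by
    rw [Finset.sum_sub_distrib, ringPotential]
    simp
  rw [h]
  refine (Finset.abs_sum_le_sum_abs _ _).trans ?_
  refine (Finset.sum_le_sum fun i _ => abs_neg_nbrInner_sub_cos_le hn hodd hΓ i).trans ?_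
  simp

/-- A continuous function that is nonpositive on a compact set only at points of `M` controls the
distance to `M` there. -/
theorem exists_forall_lt_imp_distTo_lt {M R : Set (State n)} (hR : IsClosed R) {f : State n → ℝ}
    (hf : Continuous f) (h : ∀ Γ ∈ R, f Γ ≤ 0 → Γ ∈ M) {ε : ℝ} (hε : 0 < ε) :
    ∃ η > 0, ∀ Γ ∈ R, f Γ < η → distTo M Γ < ε := by
  -- `K` collects the states of `R` at distance at least `ε / 2` from every member of `M`. It is
  -- compact and misses `M`, so the minimum of `f` on it is a positive `η`.
  set K : Set (State n) := R ∩ ⋂ Δ ∈ M, ⋃ i, {Γ | ε / 2 ≤ geoDist (Γ i) (Δ i)} with hK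
  have hKc : IsCompact K := by
    refine (hR.inter (isClosed_biInter fun Δ _ => isClosed_iUnion_of_finite fun i => ?_)).isCompact
    exact isClosed_le continuous_const ((continuous_geoDist_left _).comp (continuous_apply i))
  have hout : ∀ Γ ∈ R, Γ ∉ K → distTo M Γ < ε := by
    intro Γ hΓ hΓK
    simp only [hK, Set.mem_inter_iff, hΓ, true_and, Set.mem_iInter, Set.mem_iUnion,
      Set.mem_ofPred_eq, not_forall, not_exists, not_le] at hΓK
    obtain ⟨Δ, hΔ, hlt⟩ := hΓK
    have : stateDist Γ Δ ≤ ε / 2 := ciSup_le fun i => (hlt i).le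
    linarith [distTo_le_stateDist Γ hΔ]
  rcases K.eq_empty_or_nonempty with hemp | hne
  · exact ⟨1, one_pos, fun Γ hΓ _ => hout Γ hΓ (hemp ▸ Set.notMem_empty Γ)⟩
  · obtain ⟨Γm, hΓm, hmin⟩ := hKc.exists_isMinOn hne hf.continuousOn
    refine ⟨f Γm, ?_, fun Γ hΓ hlt => hout Γ hΓ fun hΓK => absurd (hmin hΓK) (not_le.2 hlt)⟩
    by_contra hle
    have hM := h Γm hΓm.1 (not_lt.1 hle)
    obtain ⟨i, hi⟩ := Set.mem_iUnion.1 (Set.mem_iInter₂.1 hΓm.2 Γm hM)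
    rw [Set.mem_ofPred_eq, geoDist_self] at hi
    linarith

theorem isClosed_setOf_forall_le_neg_nbrInner (m : ℝ) :
    IsClosed {Γ : State n | ∀ i, m ≤ -nbrInner Γ i} := by
  simp only [Set.ofPred_forall]
  exact isClosed_iInter fun i => isClosed_le continuous_const (continuous_nbrInner i).neg

/-! ### Convergence, maximality of the potential, and the conclusions. -/

/-- Trajectories with neighbours that are initially far apart converge to cyclic formations. -/
theorem IsTrajectory.tendsto_distTo (hn : 3 ≤ n) (hodd : Odd n) {G : Digraph (Fin n)}
    (hG : IsUndirectedRing G ∨ IsDirectedRing G) {γ : ℝ → State n} (hγ : IsTrajectory G γ) {m : ℝ}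
    (hm : 0 < m) (hmcos : Real.cos (3 * Real.pi / n) < m) (h0 : ∀ i, m ≤ -nbrInner (γ 0) i) :
    Tendsto (fun t => distTo (cyclicFormation n) (γ t)) atTop (𝓝 0) := by
  rw [Metric.tendsto_atTop]
  intro ε hε
  obtain ⟨η, hη, hlt⟩ := exists_forall_lt_imp_distTo_lt (M := cyclicFormation n)
    (isClosed_setOf_forall_le_neg_nbrInner m) continuous_dissipation (fun Γ hΓ hle =>
      mem_cyclicFormation_of_dissipation_eq_zero hodd (fun i => hm.trans_le (hΓ i))
        (fun i => hmcos.trans_le (hΓ i)) (le_antisymm hle (dissipation_nonneg Γ))) hε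
  obtain ⟨T, hT⟩ := eventually_atTop.1
    ((hγ.tendsto_dissipation hn hG).eventually (gt_mem_nhds hη))
  refine ⟨max T 0, fun t ht => ?_⟩
  rw [Real.dist_eq, sub_zero, abs_of_nonneg (distTo_nonneg _ _)]
  exact hlt _ (fun i => hγ.le_neg_nbrInner hn hG hm h0 ((le_max_right _ _).trans ht) i)
    (hT t ((le_max_left _ _).trans ht))

/-- Among the states with neighbours far apart, cyclic formations maximize the potential. -/
theorem mem_cyclicFormation_of_le_ringPotential (hn : 3 ≤ n) (hodd : Odd n) {G : Digraph (Fin n)}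
    (hG : IsUndirectedRing G ∨ IsDirectedRing G) {Γ : State n} {m : ℝ}
    (hm : 0 < m) (hmcos : Real.cos (3 * Real.pi / n) < m) (h0 : ∀ i, m ≤ -nbrInner Γ i)
    (hU : n * Real.cos (Real.pi / n) ≤ ringPotential Γ) : Γ ∈ cyclicFormation n := by
  -- Along the flow the potential increases towards its value on cyclic formations, so it cannot
  -- start above that value. Starting at it forces a constant potential and hence zero dissipation
  -- at time `0`.
  obtain ⟨γ, hγ, rfl⟩ := exists_isTrajectory G Γ
  have hmono := hγ.monotoneOn_ringPotential hn hG
  have hlim := hγ.tendsto_distTo hn hodd hG hm hmcos h0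
  have hn0 : (0 : ℝ) < n := Nat.cast_pos.2 (NeZero.pos n)
  have hle : ∀ t, 0 ≤ t → ringPotential (γ t) ≤ n * Real.cos (Real.pi / n) := by
    intro t ht
    refine le_of_forall_pos_le_add fun ε hε => ?_
    have hpos : 0 < ε / (2 * n) := by positivity
    obtain ⟨s, hs, hts⟩ := ((hlim.eventually (gt_mem_nhds hpos)).and (eventually_ge_atTop t)).exists
    have h1 := (abs_le.1 (abs_ringPotential_sub_le hn hodd hs)).2
    have h2 := hmono (Set.mem_Ici.2 ht) (Set.mem_Ici.2 (ht.trans hts)) hts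
    have h3 : (n : ℝ) * (2 * (ε / (2 * n))) = ε := by field_simp
    simp only at h2
    linarith
  have hconst : ∀ t ∈ Set.Ici (0 : ℝ), ringPotential (γ t) = n * Real.cos (Real.pi / n) :=
    fun t ht => le_antisymm (hle t ht) (hU.trans (hmono Set.self_mem_Ici ht ht))
  obtain ⟨c, hc, hd⟩ := exists_hasDerivWithinAt_ringPotential hn hG
  have hd0 : HasDerivWithinAt (fun s => ringPotential (γ s)) 0 (Set.Ici 0) 0 :=
    (hasDerivWithinAt_const 0 _ (n * Real.cos (Real.pi / n))).congr hconst
      (hconst 0 Set.self_mem_Ici)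
  have hz := (uniqueDiffOn_Ici (0 : ℝ) 0 Set.self_mem_Ici).eq_deriv _ (hd γ hγ 0 le_rfl) hd0
  exact mem_cyclicFormation_of_dissipation_eq_zero hodd (fun i => hm.trans_le (h0 i))
    (fun i => hmcos.trans_le (h0 i)) ((mul_eq_zero.1 hz).resolve_left (by linarith))

theorem lt_neg_nbrInner_of_mem_cyclicBasin (hn : 3 ≤ n) {Γ : State n} (hΓ : Γ ∈ cyclicBasin n)
    (i : Fin n) : 0 < -nbrInner Γ i ∧ Real.cos (3 * Real.pi / n) < -nbrInner Γ i := by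
  have hn3 : (3 : ℝ) ≤ n := by exact_mod_cast hn
  have h1 : minNeighborDist Γ ≤ Real.arccos (nbrInner Γ i) :=
    ciInf_le (f := fun i => geoDist (Γ i) (Γ (i + 1))) (Set.finite_range _).bddBelow i
  have h2 : max (Real.pi - 3 * Real.pi / n) (Real.pi / 2) < Real.arccos (nbrInner Γ i) :=
    lt_of_lt_of_le hΓ h1
  have h3 : 3 * Real.pi / n ≤ Real.pi := by
    rw [div_le_iff₀ (by linarith)]
    nlinarith [Real.pi_pos]
  constructor
  · by_contra hcon
    have := Real.arccos_le_pi_div_two.2 (show 0 ≤ nbrInner Γ i by linarith)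
    linarith [le_max_right (Real.pi - 3 * Real.pi / n) (Real.pi / 2)]
  · by_contra hcon
    have h4 : Real.cos (Real.pi - 3 * Real.pi / n) ≤ nbrInner Γ i := by
      rw [Real.cos_pi_sub]
      linarith
    have h5 := Real.arccos_le_arccos h4
    have h6 : 0 ≤ 3 * Real.pi / n := by positivity
    rw [Real.arccos_cos (by linarith) (by linarith)] at h5
    linarith [le_max_left (Real.pi - 3 * Real.pi / n) (Real.pi / 2)]

theorem mem_regionOfAttraction_of_le_neg_nbrInner (hn : 3 ≤ n) (hodd : Odd n)
    {G : Digraph (Fin n)} (hG : IsUndirectedRing G ∨ IsDirectedRing G) {Γ : State n} {m : ℝ}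
    (hm : 0 < m) (hmcos : Real.cos (3 * Real.pi / n) < m) (h0 : ∀ i, m ≤ -nbrInner Γ i) :
    Γ ∈ regionOfAttraction G (cyclicFormation n) := by
  refine ⟨exists_isTrajectory G Γ, ?_⟩
  rintro γ hγ rfl
  exact hγ.tendsto_distTo hn hodd hG hm hmcos h0

theorem cyclicBasin_subset_regionOfAttraction (hn : 3 ≤ n) (hodd : Odd n)
    {G : Digraph (Fin n)} (hG : IsUndirectedRing G ∨ IsDirectedRing G) :
    cyclicBasin n ⊆ regionOfAttraction G (cyclicFormation n) := by
  intro Γ hΓ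
  obtain ⟨i₀, hi₀⟩ := Finite.exists_min fun i => -nbrInner Γ i
  obtain ⟨h1, h2⟩ := lt_neg_nbrInner_of_mem_cyclicBasin hn hΓ i₀
  exact mem_regionOfAttraction_of_le_neg_nbrInner hn hodd hG h1 h2 hi₀

/-- The potential starts at its maximal value and cannot decrease, so the state remains a maximizer.
-/
theorem isPosInvariant_cyclicFormation (hn : 3 ≤ n) (hodd : Odd n)
    {G : Digraph (Fin n)} (hG : IsUndirectedRing G ∨ IsDirectedRing G) :
    IsPosInvariant G (cyclicFormation n) := by
  obtain ⟨m, hm, hmcos, hmlt⟩ := exists_between_cos hn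
  intro γ hγ h0 t ht
  have hnbr := nbrInner_of_mem_cyclicFormation hn hodd h0
  refine mem_cyclicFormation_of_le_ringPotential hn hodd hG hm hmcos
    (fun i => hγ.le_neg_nbrInner hn hG hm (fun i => ?_) ht i) ?_
  · rw [hnbr]
    exact hmlt.le
  · have h1 := hγ.monotoneOn_ringPotential hn hG Set.self_mem_Ici (Set.mem_Ici.2 ht) ht
    have h2 : ringPotential (γ 0) = n * Real.cos (Real.pi / n) := by
      rw [ringPotential, Finset.sum_congr rfl fun i _ => hnbr i]
      simp
    exact h2 ▸ h1

theorem isStable_cyclicFormation (hn : 3 ≤ n) (hodd : Odd n)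
    {G : Digraph (Fin n)} (hG : IsUndirectedRing G ∨ IsDirectedRing G) :
    IsStable G (cyclicFormation n) := by
  obtain ⟨m, hm, hmcos, hmlt⟩ := exists_between_cos hn
  have hn0 : (0 : ℝ) < n := Nat.cast_pos.2 (NeZero.pos n)
  intro ε hε
  obtain ⟨η, hη, hlt⟩ := exists_forall_lt_imp_distTo_lt (M := cyclicFormation n)
    (isClosed_setOf_forall_le_neg_nbrInner m)
    (f := fun Γ => n * Real.cos (Real.pi / n) - ringPotential Γ)
    (continuous_const.sub continuous_ringPotential) (fun Γ hΓ hle =>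
      mem_cyclicFormation_of_le_ringPotential hn hodd hG hm hmcos hΓ (by linarith)) hε
  -- The first bound keeps every `-nbrInner` at least `m`; the second keeps the initial deficit of
  -- the potential at most `η / 2`.
  refine ⟨min ((Real.cos (Real.pi / n) - m) / 2) (η / (4 * n)),
    lt_min (by linarith) (by positivity), fun γ hγ h0 t ht => ?_⟩
  refine hlt _ (fun i => hγ.le_neg_nbrInner hn hG hm (fun i => ?_) ht i) ?_
  · have := (abs_le.1 (abs_neg_nbrInner_sub_cos_le hn hodd (h0.trans_le (min_le_left _ _)) i)).1
    linarith
  · have h1 := (abs_le.1 (abs_ringPotential_sub_le hn hodd (h0.trans_le (min_le_right _ _)))).1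
    have h2 := hγ.monotoneOn_ringPotential hn hG Set.self_mem_Ici (Set.mem_Ici.2 ht) ht
    have h3 : (n : ℝ) * (2 * (η / (4 * n))) = η / 2 := by
      field_simp
      norm_num
    simp only at h2
    linarith

theorem exists_mem_regionOfAttraction_of_distTo_lt (hn : 3 ≤ n) (hodd : Odd n)
    {G : Digraph (Fin n)} (hG : IsUndirectedRing G ∨ IsDirectedRing G) :
    ∃ δ > 0, ∀ Γ₀, distTo (cyclicFormation n) Γ₀ < δ →
      Γ₀ ∈ regionOfAttraction G (cyclicFormation n) := by
  obtain ⟨m, hm, hmcos, hmlt⟩ := exists_between_cos hn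
  refine ⟨(Real.cos (Real.pi / n) - m) / 2, by linarith, fun Γ h0 => ?_⟩
  refine mem_regionOfAttraction_of_le_neg_nbrInner hn hodd hG hm hmcos fun i => ?_
  have := (abs_le.1 (abs_neg_nbrInner_sub_cos_le hn hodd h0 i)).1
  linarith

end Ring

theorem mainTheorem4 (n : ℕ) [NeZero n] (hn : 2 ≤ n) (hodd : Odd n)
    (G : Digraph (Fin n)) (hG : IsUndirectedRing G ∨ IsDirectedRing G) :
    IsPosInvariant G (cyclicFormation n) ∧
      IsAsymptoticallyStable G (cyclicFormation n) ∧
      cyclicBasin n ⊆ regionOfAttraction G (cyclicFormation n) := by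
  have hn3 : 3 ≤ n := by
    obtain ⟨k, rfl⟩ := hodd
    omega
  exact ⟨isPosInvariant_cyclicFormation hn3 hodd hG,
    ⟨isStable_cyclicFormation hn3 hodd hG, exists_mem_regionOfAttraction_of_distTo_lt hn3 hodd hG⟩,
    cyclicBasin_subset_regionOfAttraction hn3 hodd hG⟩
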